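/- Let $\alpha,\beta$ be nonzero complex numbers with $|\alpha|^2+|\beta|^2=1$. Let $H^2(\mathbb D)$ be the Hardy space of the unit disc, let $H^2_{\alpha,\beta}$ be the closed linear span of $\{\alpha+\beta z\}\cup\{z^k : k\ge 2\}$ in $H^2(\mathbb D)$, and let $S_{\alpha,\beta}=P_{H^2_{\alpha,\beta}}M_z|_{H^2_{\alpha,\beta}}$ be the compression to $H^2_{\alpha,\beta}$ of the shift $M_z$ (multiplication by $z$), where $P_{H^2_{\alpha,\beta}}$ is the orthogonal projection of $H^2(\mathbb D)$ onto $H^2_{\alpha,\beta}$. For a set $E\subseteq H^2_{\alpha,\beta}$ let $[E]_{S_{\alpha,\beta}}$ denote the smallest closed $S_{\alpha,\beta}$-invariant subspace containing $E$. For a nonzero closed $S_{\alpha,\beta}$-invariant subspace $\mathcal M\subseteq H^2_{\alpha,\beta}$, an inner function $\theta$ is said to be associated with $\mathcal M$ if $$\overline{\operatorname{span}}\{f\in\mathcal M : f=z^2g \text{ for some } g\in H^2(\mathbb D)\}=z^2\theta H^2(\mathbb D).$$ **Theorem.** Let $\mathcal M\subseteq H^2_{\alpha,\beta}$ be a nonzero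 closed $S_{\alpha,\beta}$-invariant subspace whose associated inner function is $\theta(z)=z^n$ for some integer $n\ge 1$. Then $$\mathcal M=[\mathcal M\ominus S_{\alpha,\beta}\mathcal M]_{S_{\alpha,\beta}}.$$ -/

import Mathlib

open scoped Topology ENNReal

noncomputable section

namespace HardyCompression

/-- The Hardy space `H²(𝔻)`: a function `f(z) = ∑ aₙ zⁿ` on the unit disc with `∑ |aₙ|² < ∞` is
represented by its sequence of Taylor coefficients,
with the `ℓ²` inner product of coefficients. The function itself is `HardySpace.eval f`. -/
abbrev HardySpace : Type := lp (fun _ : ℕ => ℂ) 2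

/-- The value at `z` (meaningful for `|z| < 1`) of the function with Taylor coefficients `f`. -/
def HardySpace.eval (f : HardySpace) (z : ℂ) : ℂ := ∑' n : ℕ, f n * z ^ n

/-- The monomial `zⁿ`. -/
def monomial (n : ℕ) : HardySpace := lp.single 2 n (1 : ℂ)

/-- Coefficients of `z * f(z)`. -/
def shiftCoeff (a : ℕ → ℂ) : ℕ → ℂ
  | 0 => 0
  | n + 1 => a n

lemma hasSum_shiftCoeff (f : HardySpace) :
    HasSum (fun n => ‖shiftCoeff f n‖ ^ (2 : ℝ≥0∞).toReal) (‖f‖ ^ (2 : ℝ≥0∞).toReal) := by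
  rw [← hasSum_nat_add_iff' 1]
  simpa [shiftCoeff] using lp.hasSum_norm (p := 2) (by simp) f

/-- The Hardy shift `S = M_z` on `H²(𝔻)`, `(Sf)(z) = z f(z)`. -/
def shift : HardySpace →L[ℂ] HardySpace :=
  LinearMap.mkContinuous
    { toFun := fun f => ⟨shiftCoeff f, memℓp_gen (hasSum_shiftCoeff f).summable⟩
      map_add' := by
        intro f g
        ext n
        change shiftCoeff (⇑(f + g)) n = shiftCoeff f n + shiftCoeff g n
        cases n <;> simp [shiftCoeff]
      map_smul' := by
        intro c f
        ext n
        cases n <;> simp [shiftCoeff] }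
    1
    (by
      intro f
      have h1 := lp.hasSum_norm (p := 2) (by simp)
        (⟨shiftCoeff f, memℓp_gen (hasSum_shiftCoeff f).summable⟩ : HardySpace)
      have h2 := h1.unique (hasSum_shiftCoeff f)
      have h3 := (Real.rpow_left_inj (norm_nonneg _) (norm_nonneg f) (by simp)).1 h2
      simpa using h3.le)

/-- The Taylor series of an element of `H²(𝔻)` converges in the disc. -/
lemma HardySpace.summable_eval (f : HardySpace) {z : ℂ} (hz : ‖z‖ < 1) :
    Summable fun n : ℕ => f n * z ^ n := by
  refine Summable.of_norm_bounded (g := fun n : ℕ => ‖f‖ * ‖z‖ ^ n)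
    ((summable_geometric_of_lt_one (norm_nonneg z) hz).mul_left _) fun n => ?_
  rw [norm_mul, norm_pow]
  gcongr
  exact lp.norm_apply_le_norm (by simp) f n

/-- The shift is multiplication by `z`. -/
lemma eval_shift (f : HardySpace) {z : ℂ} (hz : ‖z‖ < 1) : (shift f).eval z = z * f.eval z := by
  have h := (shift f).summable_eval hz
  unfold HardySpace.eval
  rw [h.tsum_eq_zero_add, ← tsum_mul_left]
  have h0 : (shift f) 0 = 0 := rfl
  have hs : ∀ n, (shift f) (n + 1) = f n := fun _ => rfl
  simp only [h0, hs, zero_mul, zero_add]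
  exact tsum_congr fun n => by ring

/-- `H²_{α,β}`, the closed linear span of `α + βz` and `zⁿ`, `n ≥ 2`, in `H²(𝔻)`. -/
def H2 (α β : ℂ) : Submodule ℂ HardySpace :=
  (Submodule.span ℂ
    ({α • monomial 0 + β • monomial 1} ∪ {f | ∃ n : ℕ, 2 ≤ n ∧ f = monomial n})).topologicalClosure

instance (α β : ℂ) : CompleteSpace (H2 α β) :=
  inferInstanceAs (CompleteSpace (Submodule.topologicalClosure _))

/-- `S_{α,β}`, the compression `P M_z` restricted to `H²_{α,β}` of the Hardy shift. -/
def S (α β : ℂ) : H2 α β →L[ℂ] H2 α β :=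
  (H2 α β).orthogonalProjectionOnto ∘L shift ∘L (H2 α β).subtypeL

/-- `T M ⊆ M`. -/
def IsInvariant {H : Type*} [NormedAddCommGroup H] [InnerProductSpace ℂ H]
    (T : H →L[ℂ] H) (M : Submodule ℂ H) : Prop :=
  ∀ f ∈ M, T f ∈ M

/-- `[E]_T`, the smallest closed `T`-invariant subspace containing `E`. -/
def invariantHull {H : Type*} [NormedAddCommGroup H] [InnerProductSpace ℂ H]
    (T : H →L[ℂ] H) (E : Set H) : Submodule ℂ H :=
  sInf {N : Submodule ℂ H | IsClosed (N : Set H) ∧ IsInvariant T N ∧ E ⊆ N}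

/-- `M ⊖ T M`, the vectors of `M` that are orthogonal to `T M`. -/
def wandering {H : Type*} [NormedAddCommGroup H] [InnerProductSpace ℂ H]
    (T : H →L[ℂ] H) (M : Submodule ℂ H) : Submodule ℂ H :=
  M ⊓ (M.map T.toLinearMap)ᗮ

/-- `θ` is an inner function: bounded and holomorphic on the unit disc, with radial limits of
modulus one at almost every point of the unit circle. Only its values in the disc matter. -/
structure IsInner (θ : ℂ → ℂ) : Prop where
  holomorphic : DifferentiableOn ℂ θ (Metric.ball 0 1)
  bounded : ∃ C : ℝ, ∀ z ∈ Metric.ball (0 : ℂ) 1, ‖θ z‖ ≤ C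
  radial_limit : ∀ᵐ t : ℝ, ∃ w : ℂ, ‖w‖ = 1 ∧
    Filter.Tendsto (fun r : ℝ => θ (r * Complex.exp (t * Complex.I))) (𝓝[<] 1) (𝓝 w)

/-- The closed linear span of the elements of `M` of the form `z² g` with `g ∈ H²(𝔻)`. -/
def doubleZeroPart {α β : ℂ} (M : Submodule ℂ (H2 α β)) : Submodule ℂ (H2 α β) :=
  (Submodule.span ℂ {f : H2 α β | f ∈ M ∧ ∃ g : HardySpace, ∀ z ∈ Metric.ball (0 : ℂ) 1,
    (f : HardySpace).eval z = z ^ 2 * g.eval z}).topologicalClosure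

/-- `z² θ H²(𝔻)`. For inner `θ` all these products lie in `H²_{α,β}`, so nothing is lost by
listing only the elements of `H²_{α,β}` that have this form. -/
def zSqMul (α β : ℂ) (θ : ℂ → ℂ) : Set (H2 α β) :=
  {f | ∃ h : HardySpace, ∀ z ∈ Metric.ball (0 : ℂ) 1,
    (f : HardySpace).eval z = z ^ 2 * θ z * h.eval z}

/-- `θ` is the inner function associated with `M` (it is unique up to a unimodular constant):
the closed span of all `z² g ∈ M`, `g ∈ H²(𝔻)`, is `z² θ H²(𝔻)`. -/
structure IsAssociatedInner {α β : ℂ} (M : Submodule ℂ (H2 α β)) (θ : ℂ → ℂ) : Prop where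
  inner : IsInner θ
  doubleZeroPart_eq : (doubleZeroPart M : Set (H2 α β)) = zSqMul α β θ

end HardyCompression

end

open scoped Topology ENNReal

noncomputable section

namespace HardyCompression

/-! ### Hardy space via Taylor coefficients -/

section Coefficients

/-! Put `e = α + βz` and `λ = α * conj β`. Then `S e = λ e + β z²`, while `S` is the ordinary shift
on `z² H²`. The hypothesis on `θ` says that `M ∩ z² H² = z^(n+2) H²`.

If `M ⊆ z² H²`, then `M = z^(n+2) H²` and `z^(n+2)` is a wandering generator. Otherwise applying `S
- λ` to an element `e + z² g` of `M` lands in `z^(n+2) H²`; this determines the first `n`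
coefficients of `g`, so `M = ℂ F + z^(n+2) H²` with `F` the approximate eigenvector, `S F = λ F + c
z^(n+2)`, `c = β λ⁻ⁿ` (`IsAssociatedInner.approxEigenvector_mem`).

The vector `w = conj c F - conj λ ‖F‖² z^(n+2)` is wandering, and `(S - λ) w = A z^(n+2) (1 - q z)`
with `A = |c|² + |λ|² ‖F‖²` and `q = conj λ ‖F‖² / A`. If `|q| < 1`, the factor `1 - q z` is cyclic,
so `w` generates `z^(n+2)` and then `F`. Now `|q| < 1` means `(|λ| - |λ|²) ‖F‖² < |c|²`, which
follows from `|λ| - |λ|² ≤ 1/4` and `‖F‖² ≤ 2 |c|²` (`norm_sq_approxEigenvector_le`, where `n ≥ 1`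
enters). -/

lemma monomial_apply (k i : ℕ) : (monomial k : HardySpace) i = if i = k then 1 else 0 := by
  simp [monomial, lp.single_apply, Pi.single_apply]

lemma inner_monomial (k : ℕ) (f : HardySpace) : inner ℂ (monomial k) f = f k := by
  simp [monomial, lp.inner_single_left]

lemma norm_monomial (k : ℕ) : ‖monomial k‖ = 1 := by
  simp [monomial, lp.norm_single]

@[simp] lemma shift_apply_zero (f : HardySpace) : shift f 0 = 0 := rfl

@[simp] lemma shift_apply_succ (f : HardySpace) (k : ℕ) : shift f (k + 1) = f k := rfl

lemma shift_monomial (k : ℕ) : shift (monomial k) = monomial (k + 1) := by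
  ext i
  cases i <;> simp [monomial_apply]

lemma shift_pow_succ_apply (j : ℕ) (f : HardySpace) :
    (shift ^ (j + 1)) f = shift ((shift ^ j) f) := by
  rw [pow_succ']
  rfl

lemma shift_pow_shift (j : ℕ) (f : HardySpace) :
    (shift ^ j) (shift f) = shift ((shift ^ j) f) := by
  rw [← shift_pow_succ_apply, pow_succ]
  rfl

lemma shift_pow_monomial (j k : ℕ) : (shift ^ j) (monomial k) = monomial (k + j) := by
  induction j with
  | zero => rfl
  | succ j ih => rw [shift_pow_succ_apply, ih, shift_monomial, add_assoc]

lemma shift_pow_apply_of_lt {j i : ℕ} (h : i < j) (f : HardySpace) : (shift ^ j) f i = 0 := by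
  induction j generalizing i with
  | zero => omega
  | succ j ih =>
    rw [shift_pow_succ_apply]
    cases i with
    | zero => rfl
    | succ i => exact ih (by omega)

lemma eval_shift_pow (j : ℕ) (f : HardySpace) {z : ℂ} (hz : ‖z‖ < 1) :
    ((shift ^ j) f).eval z = z ^ j * f.eval z := by
  induction j with
  | zero => simp
  | succ j ih => rw [shift_pow_succ_apply, eval_shift _ hz, ih, pow_succ']; ring

/-- An element of `H²` whose first `j` Taylor coefficients vanish is divisible by `z ^ j`. -/
lemma exists_eq_shift_pow (j : ℕ) (f : HardySpace) (hf : ∀ i < j, f i = 0) :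
    ∃ g, f = (shift ^ j) g := by
  induction j generalizing f with
  | zero => exact ⟨f, rfl⟩
  | succ j ih =>
    have hs : Summable fun i => ‖f (i + 1)‖ ^ (2 : ℝ≥0∞).toReal :=
      (summable_nat_add_iff 1).2 (lp.hasSum_norm (p := 2) (by simp) f).summable
    obtain ⟨g, hg⟩ := ih ⟨fun i => f (i + 1), memℓp_gen hs⟩ fun i hi => hf _ (by omega)
    refine ⟨g, ?_⟩
    rw [shift_pow_succ_apply, ← hg]
    ext i
    cases i with
    | zero => exact hf 0 (by omega)
    | succ i => rfl

/-- An element of `H²` is determined by its values in the disc. -/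
lemma eq_of_eval_eq {f g : HardySpace} (h : ∀ z ∈ Metric.ball (0 : ℂ) 1, f.eval z = g.eval z) :
    f = g := by
  have key : ∀ f : HardySpace, HasFPowerSeriesAt f.eval
      (FormalMultilinearSeries.ofScalars ℂ (f : ℕ → ℂ)) 0 := fun f => by
    rw [hasFPowerSeriesAt_iff]
    filter_upwards [Metric.ball_mem_nhds (0 : ℂ) one_pos] with z hz
    have := (f.summable_eval (mem_ball_zero_iff.1 hz)).hasSum
    simpa [HardySpace.eval, FormalMultilinearSeries.coeff_ofScalars, mul_comm] using this
  have hg := (key g).congr (g := f.eval) (by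
    filter_upwards [Metric.ball_mem_nhds (0 : ℂ) one_pos] with z hz using (h z hz).symm)
  have := FormalMultilinearSeries.ofScalars_series_injective ℂ ℂ
    ((key f).eq_formalMultilinearSeries hg)
  exact lp.ext this

/-- A closed subspace containing the images of the monomials contains the whole range. -/
lemma map_mem_of_monomial_mem {H : Type*} [NormedAddCommGroup H] [NormedSpace ℂ H]
    (L : HardySpace →L[ℂ] H) {N : Submodule ℂ H} (hN : IsClosed (N : Set H))
    (h : ∀ k, L (monomial k) ∈ N) (f : HardySpace) : L f ∈ N := by
  have hs := (lp.hasSum_single (p := 2) (by simp) f).mapL L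
  refine hN.mem_of_tendsto hs (Filter.Eventually.of_forall fun s => N.sum_mem fun k _ => ?_)
  have : (lp.single 2 k (f k) : HardySpace) = f k • monomial k := by
    rw [monomial, ← lp.single_smul]; simp
  rw [this, map_smul]
  exact N.smul_mem _ (h k)

end Coefficients

/-! ### The compression in the basis `α + βz`, `z²`, `z³`, … -/

section Compression

variable (α β : ℂ)

lemma monomial_mem_H2 (k : ℕ) : monomial (k + 2) ∈ H2 α β :=
  Submodule.le_topologicalClosure _ (Submodule.subset_span (Or.inr ⟨k + 2, by omega, rfl⟩))

lemma shift_sq_mem_H2 (g : HardySpace) : (shift ^ 2) g ∈ H2 α β :=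
  map_mem_of_monomial_mem _ (Submodule.isClosed_topologicalClosure _)
    (fun k => by rw [shift_pow_monomial]; exact monomial_mem_H2 α β k) g

/-- Multiplication by `z²` as a map from `H²` to `H²_{α,β}`. -/
def zSq : HardySpace →L[ℂ] H2 α β :=
  (shift ^ 2).codRestrict (H2 α β) (shift_sq_mem_H2 α β)

/-- The function `α + βz` as an element of `H²_{α,β}`. -/
def affine : H2 α β :=
  ⟨α • monomial 0 + β • monomial 1,
    Submodule.le_topologicalClosure _ (Submodule.subset_span (Or.inl rfl))⟩

lemma coe_zSq (g : HardySpace) : (zSq α β g : HardySpace) = (shift ^ 2) g := rfl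

lemma coe_affine : (affine α β : HardySpace) = α • monomial 0 + β • monomial 1 := rfl

lemma affine_apply (k : ℕ) : (affine α β : HardySpace) k =
    α * (monomial 0 : HardySpace) k + β * (monomial 1 : HardySpace) k := rfl

variable {α β}

/-- The relation is a closed linear condition, and every generator satisfies it. -/
lemma coeff_eq_of_mem_H2 {f : HardySpace} (hf : f ∈ H2 α β) : β * f 0 = α * f 1 := by
  let φ : HardySpace →L[ℂ] ℂ := β • innerSL ℂ (monomial 0) - α • innerSL ℂ (monomial 1)
  have hφ : ∀ f, φ f = β * f 0 - α * f 1 := fun f => by simp [φ, inner_monomial]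
  have : H2 α β ≤ LinearMap.ker φ.toLinearMap := by
    refine Submodule.topologicalClosure_minimal _ ?_ φ.isClosed_ker
    rw [Submodule.span_le]
    rintro f (hf | ⟨n, hn, rfl⟩)
    · rw [Set.mem_singleton_iff.1 hf, SetLike.mem_coe, LinearMap.mem_ker]
      refine (hφ _).trans ?_
      rw [← coe_affine, affine_apply, affine_apply]
      simp [monomial_apply, mul_comm]
    · have h0 : 0 ≠ n := by omega
      have h1 : 1 ≠ n := by omega
      simp [hφ, monomial_apply, h0, h1]
  have h := this hf
  rw [LinearMap.mem_ker] at h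
  exact sub_eq_zero.1 ((hφ f).symm.trans h)

lemma exists_eq_affine_add_zSq (hα : α ≠ 0) (f : H2 α β) :
    ∃ (a : ℂ) (g : HardySpace), f = a • affine α β + zSq α β g := by
  let a := (f : HardySpace) 0 / α
  have happ : ∀ i, ((f : HardySpace) - a • (affine α β : HardySpace)) i =
      (f : HardySpace) i - a * (α * (monomial 0 : HardySpace) i + β * (monomial 1 : HardySpace) i) :=
    fun i => rfl
  have h0 : ∀ i < 2, ((f : HardySpace) - a • (affine α β : HardySpace)) i = 0 := by
    have := coeff_eq_of_mem_H2 f.2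
    intro i hi
    rw [happ]
    interval_cases i
    · simp [monomial_apply, a, hα]
    · simp [monomial_apply, a]
      field_simp
      linear_combination -this
  obtain ⟨g, hg⟩ := exists_eq_shift_pow 2 _ h0
  refine ⟨a, g, Subtype.ext ?_⟩
  rw [Submodule.coe_add, coe_zSq, ← hg]
  simp

lemma inner_affine_zSq (g : HardySpace) : inner ℂ (affine α β) (zSq α β g) = 0 := by
  rw [Submodule.coe_inner, coe_affine, coe_zSq, inner_add_left, inner_smul_left, inner_smul_left,
    inner_monomial, inner_monomial, shift_pow_apply_of_lt (by omega),
    shift_pow_apply_of_lt (by omega)]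
  simp

lemma inner_zSq_monomial (k : ℕ) (g : HardySpace) :
    inner ℂ (zSq α β (monomial k)) (zSq α β g) = g k := by
  rw [Submodule.coe_inner, coe_zSq, coe_zSq, shift_pow_monomial, inner_monomial]
  rfl

lemma norm_zSq_monomial (k : ℕ) : ‖zSq α β (monomial k)‖ = 1 := by
  rw [Submodule.coe_norm, coe_zSq, shift_pow_monomial, norm_monomial]

lemma inner_affine_self (hαβ : ‖α‖ ^ 2 + ‖β‖ ^ 2 = 1) : inner ℂ (affine α β) (affine α β) = 1 := by
  rw [Submodule.coe_inner, coe_affine, inner_add_left, inner_smul_left, inner_smul_left,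
    inner_monomial, inner_monomial, ← coe_affine, affine_apply, affine_apply]
  simp [monomial_apply, Complex.conj_mul']
  exact_mod_cast hαβ

lemma S_eq_of_inner_eq_zero {f v : H2 α β}
    (h : ∀ w ∈ H2 α β, inner ℂ (shift f - (v : HardySpace)) w = 0) : S α β f = v :=
  Subtype.ext (Submodule.eq_starProjection_of_mem_of_inner_eq_zero v.2 h)

lemma S_zSq (g : HardySpace) : S α β (zSq α β g) = zSq α β (shift g) := by
  refine S_eq_of_inner_eq_zero fun w _ => ?_
  rw [coe_zSq, coe_zSq, shift_pow_shift, sub_self, inner_zero_left]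

lemma S_affine (hαβ : ‖α‖ ^ 2 + ‖β‖ ^ 2 = 1) :
    S α β (affine α β) =
      (α * starRingEnd ℂ β) • affine α β + β • zSq α β (monomial 0) := by
  refine S_eq_of_inner_eq_zero fun w hw => ?_
  have h1 : α * starRingEnd ℂ α + β * starRingEnd ℂ β = 1 := by
    rw [Complex.mul_conj', Complex.mul_conj']; exact_mod_cast hαβ
  -- The error is a multiple of `conj α z - conj β`, whose orthogonality to `w` is exactly the
  -- coefficient relation of `H2`.
  have key : shift (affine α β) - (((α * starRingEnd ℂ β) • affine α β
      + β • zSq α β (monomial 0) : H2 α β) : HardySpace) =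
      α ^ 2 • (starRingEnd ℂ α • monomial 1 - starRingEnd ℂ β • monomial 0) := by
    simp only [Submodule.coe_add, Submodule.coe_smul, coe_zSq, coe_affine, map_add, map_smul,
      shift_monomial, shift_pow_monomial]
    norm_num
    have : α = α * (α * starRingEnd ℂ α + β * starRingEnd ℂ β) := by rw [h1, mul_one]
    nth_rw 1 [this]
    module
  rw [key, inner_smul_left, inner_sub_left, inner_smul_left, inner_smul_left, inner_monomial,
    inner_monomial]
  simp [coeff_eq_of_mem_H2 hw]

end Compression

end HardyCompression
end

noncomputable section

namespace HardyCompression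

section Inner

variable {α β : ℂ}

lemma H2_inner_smul_left (a : ℂ) (f g : H2 α β) :
    inner ℂ (a • f) g = starRingEnd ℂ a * inner ℂ f g :=
  inner_smul_left (f : HardySpace) g a

lemma H2_inner_smul_right (a : ℂ) (f g : H2 α β) :
    inner ℂ f (a • g) = a * inner ℂ f g :=
  inner_smul_right (f : HardySpace) g a

lemma H2_inner_self (f : H2 α β) : inner ℂ f f = (‖f‖ : ℂ) ^ 2 :=
  inner_self_eq_norm_sq_to_K (𝕜 := ℂ) (f : HardySpace)

end Inner

/-! ### Approximate eigenvectors and their norms -/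

section Eigenvector

variable (α β : ℂ)

/-- `α + βz + z² ∑ k < n, β μ ^ (k + 1) z ^ k`. With `μ` the inverse of `α * conj β` this is an
eigenvector of the compression modulo `z ^ (n + 2) H²`. -/
def approxEigenvector (μ : ℂ) (n : ℕ) : H2 α β :=
  affine α β + ∑ k ∈ Finset.range n, (β * μ ^ (k + 1)) • zSq α β (monomial k)

variable {α β}

lemma approxEigenvector_succ (μ : ℂ) (n : ℕ) :
    approxEigenvector α β μ (n + 1) =
      approxEigenvector α β μ n + (β * μ ^ (n + 1)) • zSq α β (monomial n) := by
  rw [approxEigenvector, Finset.sum_range_succ, ← add_assoc]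
  rfl

/-- Each added term is chosen so that its multiple by `α * conj β` absorbs the previous defect,
which moves up one degree. -/
lemma S_approxEigenvector (hαβ : ‖α‖ ^ 2 + ‖β‖ ^ 2 = 1) {μ : ℂ}
    (hμ : α * starRingEnd ℂ β * μ = 1) (n : ℕ) :
    S α β (approxEigenvector α β μ n) = (α * starRingEnd ℂ β) • approxEigenvector α β μ n +
      (β * μ ^ n) • zSq α β (monomial n) := by
  induction n with
  | zero => simp [approxEigenvector, S_affine hαβ]
  | succ n ih =>
    have : β * μ ^ n = α * starRingEnd ℂ β * (β * μ ^ (n + 1)) := by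
      linear_combination (-(β * μ ^ n)) * hμ
    rw [approxEigenvector_succ, map_add, ih, map_smul, S_zSq, shift_monomial, this]
    module

lemma inner_approxEigenvector_zSq {n : ℕ} (μ : ℂ) (g : HardySpace) (hg : ∀ k < n, g k = 0) :
    inner ℂ (approxEigenvector α β μ n) (zSq α β g) = 0 := by
  rw [approxEigenvector, inner_add_left, inner_affine_zSq, sum_inner, zero_add]
  refine Finset.sum_eq_zero fun k hk => ?_
  rw [H2_inner_smul_left, inner_zSq_monomial, hg k (Finset.mem_range.1 hk), mul_zero]

lemma norm_sq_approxEigenvector_succ (μ : ℂ) (n : ℕ) :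
    ‖approxEigenvector α β μ (n + 1)‖ ^ 2 =
      ‖approxEigenvector α β μ n‖ ^ 2 + ‖β * μ ^ (n + 1)‖ ^ 2 := by
  rw [approxEigenvector_succ, pow_two, pow_two, pow_two,
    norm_add_sq_eq_norm_sq_add_norm_sq_of_inner_eq_zero (𝕜 := ℂ), norm_smul, norm_zSq_monomial,
    mul_one]
  rw [H2_inner_smul_right, inner_approxEigenvector_zSq, mul_zero]
  intro k hk
  simp [monomial_apply, hk.ne]

lemma norm_affine (hαβ : ‖α‖ ^ 2 + ‖β‖ ^ 2 = 1) : ‖affine α β‖ = 1 := by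
  have h := inner_affine_self hαβ
  rw [H2_inner_self] at h
  have h' : ‖affine α β‖ ^ 2 = 1 := by exact_mod_cast h
  exact (pow_eq_one_iff_of_nonneg (norm_nonneg _) two_ne_zero).1 h'

/-- The bound which makes the generator of the wandering subspace cyclic. -/
lemma norm_sq_approxEigenvector_le (hαβ : ‖α‖ ^ 2 + ‖β‖ ^ 2 = 1) {μ : ℂ}
    (hμ : α * starRingEnd ℂ β * μ = 1) (n : ℕ) :
    ‖approxEigenvector α β μ (n + 1)‖ ^ 2 ≤ 2 * ‖β * μ ^ (n + 1)‖ ^ 2 := by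
  have hμ' : ‖α‖ * ‖β‖ * ‖μ‖ = 1 := by
    have := congrArg norm hμ
    simpa using this
  have hα1 : ‖α‖ ≤ 1 := by nlinarith [norm_nonneg α, sq_nonneg ‖β‖]
  induction n with
  | zero =>
    rw [norm_sq_approxEigenvector_succ]
    have h0 : ‖approxEigenvector α β μ 0‖ = 1 := by
      simp [approxEigenvector, norm_affine hαβ]
    -- Here `|βμ| = 1 / |α|`.
    have h1 : 1 ≤ ‖β * μ ^ (0 + 1)‖ := by
      rw [zero_add, pow_one, norm_mul, ← hμ', mul_assoc]
      exact mul_le_of_le_one_left (by positivity) hα1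
    rw [h0]
    nlinarith
  | succ n ih =>
    rw [norm_sq_approxEigenvector_succ]
    -- By AM-GM, `|α||β| ≤ 1/2`; the induction then needs only `|μ|² ≥ 2`.
    have h2 : 2 ≤ ‖μ‖ := by
      nlinarith [sq_nonneg (‖α‖ - ‖β‖), norm_nonneg μ]
    have h3 : ‖β * μ ^ (n + 1 + 1)‖ = ‖β * μ ^ (n + 1)‖ * ‖μ‖ := by
      rw [pow_succ, ← mul_assoc, norm_mul]
    rw [h3]
    nlinarith [sq_nonneg ‖β * μ ^ (n + 1)‖, mul_nonneg (sq_nonneg ‖β * μ ^ (n + 1)‖)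
      (by nlinarith : (0 : ℝ) ≤ ‖μ‖ ^ 2 - 2)]

end Eigenvector

/-! ### Generating `z^(n+2) H²` -/

section Invariant

variable {α β : ℂ} {N : Submodule ℂ (H2 α β)}

lemma zSq_shift_pow_mem (hNc : IsClosed (N : Set (H2 α β))) (hN : IsInvariant (S α β) N) {n : ℕ}
    (h : zSq α β (monomial n) ∈ N) (g : HardySpace) : zSq α β ((shift ^ n) g) ∈ N := by
  refine map_mem_of_monomial_mem (zSq α β ∘L shift ^ n) hNc (fun k => ?_) g
  rw [ContinuousLinearMap.comp_apply, shift_pow_monomial]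
  induction k with
  | zero => rwa [zero_add]
  | succ k ih =>
    rw [add_right_comm, ← shift_monomial, ← S_zSq]
    exact hN _ ih

/-- The function `1 - qz` with `|q| < 1` is cyclic. -/
lemma zSq_monomial_mem_of_sub_mem (hNc : IsClosed (N : Set (H2 α β)))
    (hN : IsInvariant (S α β) N) {n : ℕ} {q : ℂ} (hq : ‖q‖ < 1)
    (h : zSq α β (monomial n) - q • zSq α β (monomial (n + 1)) ∈ N) :
    zSq α β (monomial n) ∈ N := by
  have hk : ∀ k, zSq α β (monomial (n + k)) - q • zSq α β (monomial (n + k + 1)) ∈ N := fun k => by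
    induction k with
    | zero => exact h
    | succ k ih =>
      have := hN _ ih
      rwa [map_sub, map_smul, S_zSq, S_zSq, shift_monomial, shift_monomial] at this
  -- Telescoping: `(1 - qz) ∑ j < k, (qz)^j = 1 - (qz)^k`, and the remainder tends to zero.
  have hsum : ∀ k, zSq α β (monomial n) - q ^ k • zSq α β (monomial (n + k)) ∈ N := fun k => by
    induction k with
    | zero => simp
    | succ k ih =>
      convert! N.add_mem ih (N.smul_mem (q ^ k) (hk k)) using 1
      rw [pow_succ, ← add_assoc]
      module
  refine hNc.mem_of_tendsto (b := Filter.atTop) ?_ (Filter.Eventually.of_forall hsum)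
  have h0 : Filter.Tendsto (fun k => q ^ k • zSq α β (monomial (n + k))) Filter.atTop (𝓝 0) := by
    refine squeeze_zero_norm (fun k => ?_) (tendsto_pow_atTop_nhds_zero_of_lt_one (norm_nonneg q) hq)
    rw [norm_smul, norm_zSq_monomial, norm_pow, mul_one]
  simpa using h0.const_sub (zSq α β (monomial n))

end Invariant

/-! ### Consequences of `θ = zⁿ` -/

section Associated

variable {α β : ℂ} {M : Submodule ℂ (H2 α β)} {θ : ℂ → ℂ} {n : ℕ}

lemma IsAssociatedInner.exists_eq_shift_pow (hθ : IsAssociatedInner M θ)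
    (hθn : ∀ z ∈ Metric.ball (0 : ℂ) 1, θ z = z ^ n) {g : HardySpace} (hg : zSq α β g ∈ M) :
    ∃ h, g = (shift ^ n) h := by
  have hmem : zSq α β g ∈ doubleZeroPart M :=
    Submodule.le_topologicalClosure _ (Submodule.subset_span
      ⟨hg, g, fun z hz => eval_shift_pow 2 g (mem_ball_zero_iff.1 hz)⟩)
  rw [← SetLike.mem_coe, hθ.doubleZeroPart_eq] at hmem
  obtain ⟨h, hh⟩ := hmem
  refine ⟨h, ?_⟩
  have : (shift ^ 2) g = (shift ^ 2) ((shift ^ n) h) := eq_of_eval_eq fun z hz => by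
    have hz' := mem_ball_zero_iff.1 hz
    rw [eval_shift_pow 2 ((shift ^ n) h) hz', eval_shift_pow n _ hz', ← mul_assoc, ← hθn z hz]
    exact hh z hz
  exact lp.ext (funext fun i => congrArg (fun f : HardySpace => f (i + 2)) this)

lemma IsAssociatedInner.zSq_shift_pow_mem (hθ : IsAssociatedInner M θ)
    (hM : IsClosed (M : Set (H2 α β)))
    (hθn : ∀ z ∈ Metric.ball (0 : ℂ) 1, θ z = z ^ n) (h : HardySpace) :
    zSq α β ((shift ^ n) h) ∈ M := by
  have hle : doubleZeroPart M ≤ M :=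
    Submodule.topologicalClosure_minimal _ (Submodule.span_le.2 fun f hf => hf.1) hM
  apply hle
  rw [← SetLike.mem_coe, hθ.doubleZeroPart_eq]
  refine ⟨h, fun z hz => ?_⟩
  have hz' := mem_ball_zero_iff.1 hz
  rw [hθn z hz, coe_zSq, eval_shift_pow 2 _ hz', eval_shift_pow n _ hz', mul_assoc]

/-- An invariant subspace not contained in `z² H²` contains the approximate eigenvector. -/
lemma IsAssociatedInner.approxEigenvector_mem (hθ : IsAssociatedInner M θ)
    (hM : IsClosed (M : Set (H2 α β))) (hMinv : IsInvariant (S α β) M)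
    (hθn : ∀ z ∈ Metric.ball (0 : ℂ) 1, θ z = z ^ n) (hαβ : ‖α‖ ^ 2 + ‖β‖ ^ 2 = 1) {μ : ℂ}
    (hμ : α * starRingEnd ℂ β * μ = 1) {a : ℂ} (ha : a ≠ 0) {g : HardySpace}
    (hf : a • affine α β + zSq α β g ∈ M) : approxEigenvector α β μ n ∈ M := by
  have hf' : affine α β + zSq α β (a⁻¹ • g) ∈ M := by
    convert! M.smul_mem a⁻¹ hf using 1
    rw [smul_add, smul_smul, inv_mul_cancel₀ ha, one_smul, map_smul]
  generalize a⁻¹ • g = g at hf'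
  -- Applying `S - λ` removes the `α + βz` component, so the result lies in `M ∩ z² H²`.
  have hdiff : zSq α β (β • monomial 0 + shift g - (α * starRingEnd ℂ β) • g) ∈ M := by
    convert! M.sub_mem (hMinv _ hf') (M.smul_mem (α * starRingEnd ℂ β) hf') using 1
    rw [map_add, S_affine hαβ, S_zSq, map_sub, map_add, map_smul, map_smul]
    module
  obtain ⟨h, hh⟩ := hθ.exists_eq_shift_pow hθn hdiff
  have hrec : ∀ i < n, β * (monomial 0 : HardySpace) i + shift g i =
      α * starRingEnd ℂ β * g i := fun i hi => by
    have := congrArg (fun f : HardySpace => f i) hh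
    rw [shift_pow_apply_of_lt hi] at this
    exact sub_eq_zero.1 this
  -- Vanishing below degree `n` is a first-order recursion for the coefficients, solved with ratio
  -- `μ`.
  have hcoeff : ∀ i < n, g i = β * μ ^ (i + 1) := fun i hi => by
    induction i with
    | zero =>
      have := hrec 0 hi
      simp only [monomial_apply, shift_apply_zero, if_true] at this
      linear_combination (-(g 0)) * hμ - μ * this
    | succ i ih =>
      have := hrec (i + 1) hi
      rw [shift_apply_succ, ih (by omega)] at this
      simp only [monomial_apply, Nat.succ_ne_zero, if_false] at this
      linear_combination (-(g (i + 1))) * hμ - μ * this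
  have hp : ∀ m (i : ℕ), (∑ k ∈ Finset.range m, (β * μ ^ (k + 1)) • monomial k : HardySpace) i =
      if i < m then β * μ ^ (i + 1) else 0 := fun m i => by
    rw [← inner_monomial, inner_sum]
    simp [inner_smul_right, inner_monomial, monomial_apply]
  obtain ⟨r, hr⟩ := HardyCompression.exists_eq_shift_pow n
    (g - ∑ k ∈ Finset.range n, (β * μ ^ (k + 1)) • monomial k) fun i hi => by
      refine sub_eq_zero.2 ?_
      rw [hp, if_pos hi, hcoeff i hi]
  convert! M.sub_mem hf' (hθ.zSq_shift_pow_mem hM hθn r) using 1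
  rw [← hr, map_sub, map_sum, approxEigenvector]
  simp only [map_smul]
  abel

end Associated

end HardyCompression
end

noncomputable section

namespace HardyCompression

/-! ### Wandering vectors and their cyclicity -/

section Wandering

variable {α β : ℂ} {M : Submodule ℂ (H2 α β)} {n : ℕ}

lemma zSq_monomial_mem_wandering (hmem : zSq α β (monomial n) ∈ M)
    (hM : ∀ f ∈ M, ∃ h, f = zSq α β ((shift ^ n) h)) :
    zSq α β (monomial n) ∈ wandering (S α β) M := by
  refine ⟨hmem, ?_⟩
  rw [SetLike.mem_coe, Submodule.mem_orthogonal']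
  rintro _ ⟨f, hf, rfl⟩
  obtain ⟨h, rfl⟩ := hM f hf
  change inner ℂ (zSq α β (monomial n)) (S α β (zSq α β ((shift ^ n) h))) = 0
  rw [S_zSq, ← shift_pow_succ_apply, inner_zSq_monomial, shift_pow_apply_of_lt (by omega)]

/-- `S M` is spanned by `S F = λ F + c z^(n+2)` and `z^(n+3) H²`. The second is orthogonal to both
terms, and the two coefficients make the pairing with `S F` cancel. -/
lemma approxEigenvector_sub_mem_wandering (hαβ : ‖α‖ ^ 2 + ‖β‖ ^ 2 = 1) {μ : ℂ}
    (hμ : α * starRingEnd ℂ β * μ = 1) (hF : approxEigenvector α β μ n ∈ M)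
    (hmem : zSq α β (monomial n) ∈ M)
    (hM : ∀ f ∈ M, ∃ (a : ℂ) (h : HardySpace),
      f = a • approxEigenvector α β μ n + zSq α β ((shift ^ n) h)) :
    starRingEnd ℂ (β * μ ^ n) • approxEigenvector α β μ n -
      (starRingEnd ℂ (α * starRingEnd ℂ β) * (‖approxEigenvector α β μ n‖ : ℂ) ^ 2) •
        zSq α β (monomial n) ∈ wandering (S α β) M := by
  refine ⟨M.sub_mem (M.smul_mem _ hF) (M.smul_mem _ hmem), ?_⟩
  rw [SetLike.mem_coe, Submodule.mem_orthogonal]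
  rintro _ ⟨f, hf, rfl⟩
  obtain ⟨a, h, rfl⟩ := hM f hf
  change inner ℂ (S α β (a • approxEigenvector α β μ n + zSq α β ((shift ^ n) h))) _ = 0
  have h1 : inner ℂ (approxEigenvector α β μ n) (zSq α β (monomial n)) = 0 :=
    inner_approxEigenvector_zSq μ _ fun k hk => by simp [monomial_apply, hk.ne]
  have h2 : inner ℂ (zSq α β ((shift ^ (n + 1)) h)) (approxEigenvector α β μ n) = 0 :=
    (inner_eq_zero_symm (𝕜 := ℂ) (E := H2 α β)).1 (inner_approxEigenvector_zSq μ _ fun k hk =>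
      shift_pow_apply_of_lt (by omega) h)
  have h3 : inner ℂ (zSq α β ((shift ^ (n + 1)) h)) (zSq α β (monomial n)) = 0 :=
    (inner_eq_zero_symm (𝕜 := ℂ) (E := H2 α β)).1 (by rw [inner_zSq_monomial, shift_pow_apply_of_lt (by omega)])
  have h4 : inner ℂ (zSq α β (monomial n)) (zSq α β (monomial n)) = 1 := by
    rw [inner_zSq_monomial, monomial_apply, if_pos rfl]
  rw [map_add, map_smul, S_approxEigenvector hαβ hμ, S_zSq, ← shift_pow_succ_apply]
  simp only [inner_add_left, inner_sub_right, H2_inner_smul_left, H2_inner_smul_right, h1, h2, h3,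
    h4, (inner_eq_zero_symm (𝕜 := ℂ) (E := H2 α β)).1 h1, H2_inner_self]
  ring

/-- The generator of the wandering subspace is cyclic in `M`. -/
lemma mem_of_approxEigenvector_sub_mem (hαβ : ‖α‖ ^ 2 + ‖β‖ ^ 2 = 1) {μ : ℂ}
    (hμ : α * starRingEnd ℂ β * μ = 1) (hn : 1 ≤ n) {N : Submodule ℂ (H2 α β)}
    (hNc : IsClosed (N : Set (H2 α β))) (hN : IsInvariant (S α β) N)
    (hw : starRingEnd ℂ (β * μ ^ n) • approxEigenvector α β μ n -
      (starRingEnd ℂ (α * starRingEnd ℂ β) * (‖approxEigenvector α β μ n‖ : ℂ) ^ 2) •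
        zSq α β (monomial n) ∈ N) :
    zSq α β (monomial n) ∈ N ∧ approxEigenvector α β μ n ∈ N := by
  have hle : ‖approxEigenvector α β μ n‖ ^ 2 ≤ 2 * ‖β * μ ^ n‖ ^ 2 := by
    obtain ⟨m, rfl⟩ := Nat.exists_eq_add_of_le' hn
    exact norm_sq_approxEigenvector_le hαβ hμ m
  have hS := S_approxEigenvector hαβ hμ n
  have hc : β * μ ^ n ≠ 0 := by
    refine mul_ne_zero ?_ (pow_ne_zero _ ?_) <;> rintro rfl <;> simp at hμ
  have hl : ‖α * starRingEnd ℂ β‖ ≤ 1 / 2 := by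
    rw [norm_mul, RCLike.norm_conj]
    nlinarith [sq_nonneg (‖α‖ - ‖β‖)]
  generalize approxEigenvector α β μ n = F at *
  generalize α * starRingEnd ℂ β = l at *
  generalize β * μ ^ n = c at *
  have hc' : 0 < ‖c‖ := norm_pos_iff.2 hc
  let A : ℝ := ‖c‖ ^ 2 + ‖l‖ ^ 2 * ‖F‖ ^ 2
  have hA : 0 < A := by positivity
  have hA' : (A : ℂ) ≠ 0 := by exact_mod_cast hA.ne'
  have hAc : (A : ℂ) = starRingEnd ℂ c * c + starRingEnd ℂ l * l * (‖F‖ : ℂ) ^ 2 := by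
    rw [Complex.conj_mul', Complex.conj_mul']
    simp [A]
  have hq : ‖starRingEnd ℂ l * (‖F‖ : ℂ) ^ 2 / A‖ < 1 := by
    rw [norm_div, Complex.norm_of_nonneg hA.le, div_lt_one hA, norm_mul, RCLike.norm_conj, norm_pow,
      Complex.norm_of_nonneg (norm_nonneg F)]
    change _ < ‖c‖ ^ 2 + ‖l‖ ^ 2 * ‖F‖ ^ 2
    have h1 : ‖l‖ - ‖l‖ ^ 2 ≤ 1 / 4 := by nlinarith [sq_nonneg (‖l‖ - 1 / 2)]
    have h2 := mul_le_mul_of_nonneg_right h1 (sq_nonneg ‖F‖)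
    nlinarith [pow_pos hc' 2]
  have hz : zSq α β (monomial n) ∈ N := by
    refine zSq_monomial_mem_of_sub_mem hNc hN hq ?_
    -- Applying `S - λ` to the wandering vector cancels `F` and leaves `A (z^(n+2) - q z^(n+3))`.
    convert! N.smul_mem (A : ℂ)⁻¹ (N.sub_mem (hN _ hw) (N.smul_mem l hw)) using 1
    rw [map_sub, map_smul, map_smul, hS, S_zSq, shift_monomial]
    have h1 : zSq α β (monomial n) = (A : ℂ)⁻¹ •
        (starRingEnd ℂ c * c + starRingEnd ℂ l * l * (‖F‖ : ℂ) ^ 2) • zSq α β (monomial n) := by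
      rw [← hAc, smul_smul, inv_mul_cancel₀ hA', one_smul]
    nth_rw 1 [h1]
    module
  refine ⟨hz, ?_⟩
  have hcF := N.add_mem hw (N.smul_mem (starRingEnd ℂ l * (‖F‖ : ℂ) ^ 2) hz)
  rw [sub_add_cancel] at hcF
  exact (N.smul_mem_iff ((map_ne_zero _).2 hc)).1 hcF

end Wandering

end HardyCompression
end

/-! ### The main theorem -/

open HardyCompression in
theorem theorem5p5 (α β : ℂ) (hα : α ≠ 0) (hβ : β ≠ 0) (hαβ : ‖α‖ ^ 2 + ‖β‖ ^ 2 = 1)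
    (M : Submodule ℂ (HardyCompression.H2 α β)) (hM0 : M ≠ ⊥)
    (hMclosed : IsClosed (M : Set (HardyCompression.H2 α β)))
    (hMinv : HardyCompression.IsInvariant (HardyCompression.S α β) M)
    (θ : ℂ → ℂ) (hθ : HardyCompression.IsAssociatedInner M θ)
    (n : ℕ) (hn : 1 ≤ n) (hθn : ∀ z ∈ Metric.ball (0 : ℂ) 1, θ z = z ^ n) :
    M = HardyCompression.invariantHull (HardyCompression.S α β)
      (HardyCompression.wandering (HardyCompression.S α β) M) := by
  refine le_antisymm (le_sInf ?_) (sInf_le ⟨hMclosed, hMinv, fun f hf => hf.1⟩)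
  rintro N ⟨hNc, hN, hwN⟩
  have hz : zSq α β (monomial n) ∈ M := by
    have := hθ.zSq_shift_pow_mem hMclosed hθn (monomial 0)
    rwa [shift_pow_monomial, zero_add] at this
  -- The split is whether `M` is contained in `z² H²`.
  by_cases hcase : ∃ (a : ℂ) (g : HardySpace), a ≠ 0 ∧ a • affine α β + zSq α β g ∈ M
  · obtain ⟨a, g, ha, hf⟩ := hcase
    have hμ : α * starRingEnd ℂ β * (α * starRingEnd ℂ β)⁻¹ = 1 :=
      mul_inv_cancel₀ (mul_ne_zero hα ((map_ne_zero _).2 hβ))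
    have hF := hθ.approxEigenvector_mem hMclosed hMinv hθn hαβ hμ ha hf
    have hM : ∀ f ∈ M, ∃ (a : ℂ) (h : HardySpace),
        f = a • approxEigenvector α β (α * starRingEnd ℂ β)⁻¹ n +
          zSq α β ((shift ^ n) h) := fun f hf => by
      obtain ⟨b, r, rfl⟩ := exists_eq_affine_add_zSq hα f
      have hd := M.sub_mem hf (M.smul_mem b hF)
      have heq : b • affine α β + zSq α β r -
          b • approxEigenvector α β (α * starRingEnd ℂ β)⁻¹ n = zSq α β (r -
            b • ∑ k ∈ Finset.range n, (β * (α * starRingEnd ℂ β)⁻¹ ^ (k + 1)) • monomial k) := by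
        simp only [approxEigenvector, map_sub, map_smul, map_sum]
        module
      rw [heq] at hd
      obtain ⟨h, hh⟩ := hθ.exists_eq_shift_pow hθn hd
      exact ⟨b, h, by rw [← hh, ← heq, add_sub_cancel]⟩
    obtain ⟨hzN, hFN⟩ := mem_of_approxEigenvector_sub_mem hαβ hμ hn hNc hN
      (hwN (approxEigenvector_sub_mem_wandering hαβ hμ hF hz hM))
    intro f hf
    obtain ⟨b, h, rfl⟩ := hM f hf
    exact N.add_mem (N.smul_mem b hFN) (zSq_shift_pow_mem hNc hN hzN h)
  · push Not at hcase
    have hM : ∀ f ∈ M, ∃ h, f = zSq α β ((shift ^ n) h) := fun f hf => by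
      obtain ⟨b, r, rfl⟩ := exists_eq_affine_add_zSq hα f
      have hb : b = 0 := by_contra fun hb => hcase b r hb hf
      rw [hb, zero_smul, zero_add] at hf ⊢
      obtain ⟨h, rfl⟩ := hθ.exists_eq_shift_pow hθn hf
      exact ⟨h, rfl⟩
    have hzN := hwN (zSq_monomial_mem_wandering hz hM)
    intro f hf
    obtain ⟨h, rfl⟩ := hM f hf
    exact zSq_shift_pow_mem hNc hN hzN h
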